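/- **Setting.** Let $\mathcal O\subset\mathbb R^3$ be a closed set that is triangulated: $\partial\mathcal O=\bigcup_{i=1}^N\Delta_i$, where each $\Delta_i$ is a nondegenerate closed triangle, any two distinct $\Delta_i,\Delta_j$ are disjoint or intersect in a vertex or an edge of the triangulation, and each face $\Delta_i$ has a unique outward unit normal $\mathbf n_i$ (orthogonal to $\Delta_i$; for every $\mathbf x\in\mathrm{relint}\,\Delta_i$ and all sufficiently small $t>0$, $\mathbf x+t\mathbf n_i\notin\mathcal O$ and $\mathbf x-t\mathbf n_i\in\mathcal O$). Put $\Phi=\bigcup_i\mathrm{relint}\,\Delta_i$ and $\mathbf n(\mathbf x)=\mathbf n_i$ for $\mathbf x\in\mathrm{relint}\,\Delta_i$ (should $\mathbf x$ lie in the relative interiors of several faces, fix any one of them), let $\mu$ be the surface (two-dimensional Lebesgue) measure on $\Phi$, and let $L^2[\partial\mathcal O]=L^2(\mu)$ (real-valued functions). Let the albedo $\rho:\partial\mathcal O\to(0,1]$ be $\mu$-measurable, and let $\rho_\star=\sup_{\mathbf x\in\partial\mathcal O}\rho(\mathbf x)$. For $\mathbf x\in\Phi$ and $\mathbf u\in\mathbb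 S^2$ let $\nu(\mathbf x,\mathbf u)=1$ if $\{\mathbf x+t\mathbf u: t\ge 0\}\cap\mathcal O=\{\mathbf x\}$, and $\nu(\mathbf x,\mathbf u)=0$ otherwise. The pointwise visibility and the minimum visibility are $$\tilde\nu(\mathbf x)=\frac1\pi\int_{\langle\mathbf u,\mathbf n(\mathbf x)\rangle\ge0}\langle\mathbf n(\mathbf x),\mathbf u\rangle\,\nu(\mathbf x,\mathbf u)\,d\sigma(\mathbf u),\qquad \nu_\star=\inf_{\mathbf x\in\Phi}\tilde\nu(\mathbf x),$$ where $\sigma$ is the surface measure on $\mathbb S^2$. (If $N=0$, set $\rho_\star=\nu_\star=0$.) Let $V(\mathbf x,\mathbf y)=1$ if $[\mathbf x,\mathbf y]\cap\mathcal O=\{\mathbf x,\mathbf y\}$, and $V(\mathbf x,\mathbf y)=0$ otherwise. The interreflection operator is $$\mathcal T[g](\mathbf x)=\int\kappa(\mathbf x,\mathbf y)\,g(\mathbf y)\,d\mu(\mathbf y)\quad(\mathbf x\in\Phi),\qquad \kappa(\mathbf x,\mathbf y)=\frac{\rho(\mathbf x)}{\pi}\,\frac{\langle\mathbf n(\mathbf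 y),\mathbf x-\mathbf y\rangle\,\langle\mathbf n(\mathbf x),\mathbf y-\mathbf x\rangle}{\|\mathbf x-\mathbf y\|^4}\,V(\mathbf x,\mathbf y),$$ and $\mathcal T[g]=0$ on $\partial\mathcal O\setminus\Phi$. **Lemma 5.3.** For every $g\in L^2[\partial\mathcal O]$ the integral defining $\mathcal T[g](\mathbf x)$ converges absolutely for $\mu$-almost every $\mathbf x$, and $\mathcal T$ is a bounded linear operator on $L^2[\partial\mathcal O]$ with $$\|\mathcal T\|_{L^2\to L^2}\le\rho_\star(1-\nu_\star).$$ If moreover $\nu_\star>0$ or $\rho_\star<1$, then $\rho_\star(1-\nu_\star)<1$, hence $\|\mathcal T\|_{L^2\to L^2}<1$, the operator $\mathcal I-\mathcal T$ is invertible with bounded inverse, and $$\|(\mathcal I-\mathcal T)^{-1}\|_{L^2\to L^2}\le\bigl(1-\rho_\star(1-\nu_\star)\bigr)^{-1}.$$ -/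

import Mathlib

open MeasureTheory Set Topology
open scoped RealInnerProductSpace

noncomputable section

namespace Lambertian

/-- Euclidean three-space. -/
abbrev E3 : Type := EuclideanSpace ℝ (Fin 3)

/-- The closed triangle with vertices `v 0`, `v 1`, `v 2`. -/
def triangle (v : Fin 3 → E3) : Set E3 := convexHull ℝ (range v)

/-- The relative interior of the triangle with vertices `v 0`, `v 1`, `v 2`. -/
def openTriangle (v : Fin 3 → E3) : Set E3 := intrinsicInterior ℝ (triangle v)

/-- `n` is an outward unit normal of the face with vertices `v` of the body `O`: a unit vector
orthogonal to the plane of the face such that, at each relative interior point of the face,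
one leaves `O` in the direction `n` and enters `O` in the direction `-n`. -/
structure IsOutwardNormal (O : Set E3) (v : Fin 3 → E3) (n : E3) : Prop where
  norm_eq_one : ‖n‖ = 1
  orthogonal : ∀ w ∈ vectorSpan ℝ (range v), ⟪n, w⟫ = 0
  outward : ∀ x ∈ openTriangle v, ∀ᶠ t : ℝ in 𝓝[>] 0, x + t • n ∉ O ∧ x - t • n ∈ O

/-- A triangulated object: a closed set `O ⊆ ℝ³` whose boundary is a finite union of
nondegenerate triangles, any two of which are disjoint or meet in a vertex or in an edge,
each of them having a unique outward normal. -/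
structure TriangulatedObject where
  /-- the body -/
  O : Set E3
  isClosed : IsClosed O
  /-- the number of faces -/
  N : ℕ
  /-- the vertices of the faces -/
  vertex : Fin N → Fin 3 → E3
  /-- every face is two-dimensional -/
  nondegenerate : ∀ i, AffineIndependent ℝ (vertex i)
  frontier_eq : frontier O = ⋃ i, triangle (vertex i)
  inter_eq : ∀ i j, i ≠ j →
    (triangle (vertex i) ∩ triangle (vertex j) = ∅) ∨
    (∃ m k, triangle (vertex i) ∩ triangle (vertex j) = {vertex m k}) ∨
    (∃ m k₁ k₂, k₁ ≠ k₂ ∧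
      triangle (vertex i) ∩ triangle (vertex j) = convexHull ℝ {vertex m k₁, vertex m k₂})
  exists_normal : ∀ i, ∃! n, IsOutwardNormal O (vertex i) n

namespace TriangulatedObject

variable (K : TriangulatedObject)

/-- `Φ`, the union of the relative interiors of the faces. -/
def facePoints : Set E3 := ⋃ i, openTriangle (K.vertex i)

/-- The outward normal of the `i`-th face. -/
def faceNormal (i : Fin K.N) : E3 := (K.exists_normal i).choose

open Classical in
/-- The outward normal `n(x)` at a point `x ∈ Φ`: the normal of a face with `x` in its relative
interior (junk value `0` off `Φ`). -/
def normal (x : E3) : E3 :=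
  if h : ∃ i, x ∈ openTriangle (K.vertex i) then K.faceNormal h.choose else 0

/-- The surface measure: the sum over the faces of the two-dimensional Lebesgue measure of
the part of a set that lies in the relative interior of the face. The plane of a face is
parametrized isometrically by its direction space, a two-dimensional inner product space. -/
def surfaceMeasure : Measure E3 :=
  Measure.sum fun i : Fin K.N =>
    (Measure.map (fun w : vectorSpan ℝ (range (K.vertex i)) => K.vertex i 0 + (w : E3))
      volume).restrict (openTriangle (K.vertex i))

open Classical in
/-- The point-direction visibility indicator `ν(x, u)`. -/
def dirVisibility (x u : E3) : ℝ :=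
  if {y | ∃ t : ℝ, 0 ≤ t ∧ y = x + t • u} ∩ K.O = {x} then 1 else 0

open Classical in
/-- The point-point visibility indicator `V(x, y)`. -/
def ptVisibility (x y : E3) : ℝ :=
  if segment ℝ x y ∩ K.O = {x, y} then 1 else 0

/-- The pointwise visibility: the `⟨n(x), u⟩ / π`-weighted fraction of directions `u` visible at
`x`, integrated against the surface measure of the unit sphere. -/
def visibility (x : E3) : ℝ :=
  (1 / Real.pi) * ∫ u in {u : Metric.sphere (0 : E3) 1 | 0 ≤ ⟪(u : E3), K.normal x⟫},
    ⟪K.normal x, (u : E3)⟫ * K.dirVisibility x u ∂((volume : Measure E3).toSphere)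

/-- `ν⋆`, the infimum of the pointwise visibility over all points at which the normal, hence the
pointwise visibility, is defined. -/
def minVisibility : ℝ := sInf (K.visibility '' K.facePoints)

/-- `ρ⋆`, the supremum of the albedo over the boundary. -/
def maxAlbedo (ρ : E3 → ℝ) : ℝ := sSup (ρ '' frontier K.O)

/-- The interreflection kernel `κ(x, y)`. -/
def kernel (ρ : E3 → ℝ) (x y : E3) : ℝ :=
  (ρ x / Real.pi) * (⟪K.normal y, x - y⟫ * ⟪K.normal x, y - x⟫ / ‖x - y‖ ^ 4) *
    K.ptVisibility x y

open Classical in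
/-- The function `T[g]`: the integral of `κ(x, ·) g` at `x ∈ Φ`, and `0` elsewhere. -/
def interreflect (ρ g : E3 → ℝ) (x : E3) : ℝ :=
  if x ∈ K.facePoints then ∫ y, K.kernel ρ x y * g y ∂K.surfaceMeasure else 0

/-- The real Hilbert space `L²[∂O]`. -/
abbrev L2 : Type := Lp ℝ 2 K.surfaceMeasure

/-- The bounded operator `T` on `L²[∂O]` is the interreflection operator: for each `g` in
`L²[∂O]`, the integral defining `T[g](x)` converges absolutely for almost every `x`, and its
value is `(T g)(x)`. -/
def IsInterreflectionOperator (ρ : E3 → ℝ) (T : K.L2 →L[ℝ] K.L2) : Prop :=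
  ∀ g : K.L2,
    (∀ᵐ x ∂K.surfaceMeasure, Integrable (fun y => K.kernel ρ x y * g y) K.surfaceMeasure) ∧
    (T g : E3 → ℝ) =ᵐ[K.surfaceMeasure] K.interreflect ρ g

end TriangulatedObject

end Lambertian

end

/-!
The interreflection kernel is `ρ(x)` times the form factor
`π⁻¹ ⟪n(y), x - y⟫ ⟪n(x), y - x⟫ / ‖x - y‖⁴ V(x, y)`, which is symmetric. Off a null set of points,
those that lie on two faces, it is also nonnegative: near a point of a single face the inner side of
the face belongs to the body, so that a visible point lies on the outer side
(`inner_normal_nonneg`).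

The row sums of the form factor are bounded by `1 - visibility x` (`lintegral_formFactor_le`).
Indeed `⟪n(y), x - y⟫ / ‖x - y‖³ dy` is the element of solid angle at `x`
(`lintegral_solidAngle`), so the integral over the faces becomes the integral of the cosine over
the directions in which some point of the surface is visible from `x`. Each direction contains at
most one such point, and its ray meets the body, so that the direction counts as blocked in the
visibility of `x` (`sum_faceView_le`). As the cosine has integral `π` over the hemisphere
(`lintegral_cosine`), what remains is at most `1 - visibility x`. The change of variables is
obtained without a Jacobian, by integrating a function that is homogeneous of degree `0` over the
unit ball, once in polar coordinates and once over the slices parallel to the face.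

By symmetry the columns satisfy the same bound, so that with the albedo all rows and columns have
`L¹` norm at most `ρ⋆ (1 - ν⋆)`. The Schur test (`exists_clm_of_schur`) turns this into the bound
of the operator norm, and the Neumann series (`exists_inverse_one_sub`) gives the inverse.
-/

noncomputable section

namespace Lambertian

open scoped ENNReal NNReal

/-! ### The Schur test -/

section Schur

variable {X : Type*} [MeasurableSpace X] {μ : Measure X}

/-- Cauchy–Schwarz with respect to the weight `a`. -/
lemma lintegral_mul_sq_le {a b : X → ℝ≥0∞} (ha : AEMeasurable a μ) (hb : AEMeasurable b μ) :
    (∫⁻ y, a y * b y ∂μ) ^ 2 ≤ (∫⁻ y, a y ∂μ) * ∫⁻ y, a y * b y ^ 2 ∂μ := by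
  have h2 : ∀ t : ℝ≥0∞, (t ^ (1 / 2 : ℝ)) ^ (2 : ℝ) = t := fun t => by
    rw [← ENNReal.rpow_mul]; norm_num
  have h2' : ∀ t : ℝ≥0∞, t ^ (1 / 2 : ℝ) * t ^ (1 / 2 : ℝ) = t := fun t => by
    rw [← sq, ← ENNReal.rpow_natCast]; exact_mod_cast h2 t
  have key := ENNReal.lintegral_mul_le_Lp_mul_Lq μ Real.HolderConjugate.two_two
    (ha.pow_const (1 / 2 : ℝ)) ((ha.pow_const (1 / 2 : ℝ)).mul hb)
  simp only [Pi.mul_apply, ENNReal.mul_rpow_of_nonneg _ _ zero_le_two, h2, ← mul_assoc, h2'] at key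
  calc (∫⁻ y, a y * b y ∂μ) ^ 2
      ≤ ((∫⁻ y, a y ∂μ) ^ (1 / 2 : ℝ) * (∫⁻ y, a y * b y ^ (2 : ℝ) ∂μ) ^ (1 / 2 : ℝ)) ^ 2 := by
        gcongr
    _ = _ := by
        rw [mul_pow, ← ENNReal.rpow_natCast, ← ENNReal.rpow_natCast (_ ^ (1 / 2 : ℝ))]
        simp only [Nat.cast_ofNat, h2, ENNReal.rpow_ofNat]

lemma eLpNorm_two_sq (f : X → ℝ) : eLpNorm f 2 μ ^ 2 = ∫⁻ x, ‖f x‖ₑ ^ 2 ∂μ := by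
  have := eLpNorm_nnreal_pow_eq_lintegral (μ := μ) (f := f) (p := 2) (by norm_num)
  simpa using this

variable [SFinite μ] {k : X → X → ℝ} {C : ℝ≥0}

/-- The pointwise majorant `∫ |k(x, y)| |g(y)| dμ(y)` is square integrable, with the Schur
constant. -/
lemma lintegral_schur_le (hk : AEStronglyMeasurable (fun p : X × X => k p.1 p.2) (μ.prod μ))
    (hrow : ∀ᵐ x ∂μ, ∫⁻ y, ‖k x y‖ₑ ∂μ ≤ C) (hcol : ∀ᵐ y ∂μ, ∫⁻ x, ‖k x y‖ₑ ∂μ ≤ C)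
    {g : X → ℝ} (hg : AEStronglyMeasurable g μ) :
    ∫⁻ x, (∫⁻ y, ‖k x y‖ₑ * ‖g y‖ₑ ∂μ) ^ 2 ∂μ ≤ C ^ 2 * ∫⁻ y, ‖g y‖ₑ ^ 2 ∂μ := by
  have hkm : AEMeasurable (fun p : X × X => ‖k p.1 p.2‖ₑ) (μ.prod μ) := hk.enorm
  have hsec : ∀ᵐ x ∂μ, AEMeasurable (fun y => ‖k x y‖ₑ) μ := by
    filter_upwards [hk.prodMk_left] with x hx using hx.enorm
  have hjoint : AEMeasurable (fun p : X × X => ‖k p.1 p.2‖ₑ * ‖g p.2‖ₑ ^ 2) (μ.prod μ) :=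
    hkm.mul ((hg.comp_snd (μ := μ)).enorm.pow_const 2)
  calc ∫⁻ x, (∫⁻ y, ‖k x y‖ₑ * ‖g y‖ₑ ∂μ) ^ 2 ∂μ
      ≤ ∫⁻ x, C * ∫⁻ y, ‖k x y‖ₑ * ‖g y‖ₑ ^ 2 ∂μ ∂μ := by
        refine lintegral_mono_ae ?_
        filter_upwards [hrow, hsec] with x hx hm
        exact (lintegral_mul_sq_le hm hg.enorm).trans (by gcongr)
    _ = C * ∫⁻ x, ∫⁻ y, ‖k x y‖ₑ * ‖g y‖ₑ ^ 2 ∂μ ∂μ := lintegral_const_mul' _ _ (by simp)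
    _ = C * ∫⁻ y, ∫⁻ x, ‖k x y‖ₑ * ‖g y‖ₑ ^ 2 ∂μ ∂μ := by
        rw [lintegral_lintegral_swap hjoint]
    _ ≤ C * ∫⁻ y, C * ‖g y‖ₑ ^ 2 ∂μ := by
        refine mul_le_mul_right (lintegral_mono_ae ?_) _
        filter_upwards [hcol] with y hy
        rw [lintegral_mul_const' _ _ (by simp)]
        gcongr
    _ = _ := by rw [lintegral_const_mul' _ _ (by simp), ← mul_assoc, sq]

/-- **Schur test**: a kernel whose rows and columns have `L¹` norm at most `C` defines an operator
of norm at most `C` on `L²`. -/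
theorem exists_clm_of_schur
    (hk : AEStronglyMeasurable (fun p : X × X => k p.1 p.2) (μ.prod μ))
    (hrow : ∀ᵐ x ∂μ, ∫⁻ y, ‖k x y‖ₑ ∂μ ≤ C) (hcol : ∀ᵐ y ∂μ, ∫⁻ x, ‖k x y‖ₑ ∂μ ≤ C) :
    ∃ T : Lp ℝ 2 μ →L[ℝ] Lp ℝ 2 μ, ‖T‖ ≤ C ∧ ∀ g : Lp ℝ 2 μ,
      (∀ᵐ x ∂μ, Integrable (fun y => k x y * g y) μ) ∧
      (T g : X → ℝ) =ᵐ[μ] fun x => ∫ y, k x y * g y ∂μ := by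
  have hjoint (g : Lp ℝ 2 μ) :
      AEStronglyMeasurable (fun p : X × X => k p.1 p.2 * g p.2) (μ.prod μ) :=
    hk.mul ((Lp.aestronglyMeasurable g).comp_snd (μ := μ))
  have hle (g : Lp ℝ 2 μ) : ∫⁻ x, (∫⁻ y, ‖k x y * g y‖ₑ ∂μ) ^ 2 ∂μ
      ≤ C ^ 2 * eLpNorm g 2 μ ^ 2 := by
    simpa only [enorm_mul, eLpNorm_two_sq] using
      lintegral_schur_le hk hrow hcol (Lp.aestronglyMeasurable g)
  have hint (g : Lp ℝ 2 μ) : ∀ᵐ x ∂μ, Integrable (fun y => k x y * g y) μ := by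
    have hfin : ∫⁻ x, (∫⁻ y, ‖k x y * g y‖ₑ ∂μ) ^ 2 ∂μ ≠ ∞ :=
      ne_top_of_le_ne_top (ENNReal.mul_ne_top (by simp) (by simpa using Lp.eLpNorm_ne_top g))
        (hle g)
    filter_upwards [ae_lt_top' ((hjoint g).enorm.lintegral_prod_right'.pow_const 2) hfin,
      (hjoint g).prodMk_left] with x hx hm
    exact ⟨hm, by simpa [HasFiniteIntegral] using hx⟩
  have hnorm (g : Lp ℝ 2 μ) :
      eLpNorm (fun x => ∫ y, k x y * g y ∂μ) 2 μ ≤ C * eLpNorm g 2 μ := by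
    rw [← ENNReal.pow_le_pow_left_iff (n := 2) (by norm_num), mul_pow, eLpNorm_two_sq]
    refine le_trans (lintegral_mono fun x => ?_) (hle g)
    gcongr
    exact enorm_integral_le_lintegral_enorm _
  have hmem (g : Lp ℝ 2 μ) : MemLp (fun x => ∫ y, k x y * g y ∂μ) 2 μ :=
    ⟨(hjoint g).integral_prod_right',
      (hnorm g).trans_lt (ENNReal.mul_lt_top (by simp) (Lp.eLpNorm_lt_top g))⟩
  let L : Lp ℝ 2 μ →ₗ[ℝ] Lp ℝ 2 μ :=
    { toFun := fun g => (hmem g).toLp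
      map_add' := fun g h => by
        rw [← MemLp.toLp_add, MemLp.toLp_eq_toLp_iff]
        filter_upwards [hint g, hint h] with x hg hh
        rw [Pi.add_apply, ← integral_add hg hh]
        refine integral_congr_ae ?_
        filter_upwards [Lp.coeFn_add g h] with y hy
        rw [hy, Pi.add_apply, mul_add]
      map_smul' := fun c g => by
        rw [RingHom.id_apply, ← MemLp.toLp_const_smul, MemLp.toLp_eq_toLp_iff]
        filter_upwards with x
        rw [Pi.smul_apply, smul_eq_mul, ← integral_const_mul]
        refine integral_congr_ae ?_
        filter_upwards [Lp.coeFn_smul c g] with y hy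
        rw [hy, Pi.smul_apply, smul_eq_mul, mul_left_comm] }
  refine ⟨L.mkContinuous C fun g => ?_, L.mkContinuous_norm_le C.2 _, fun g =>
    ⟨hint g, (hmem g).coeFn_toLp⟩⟩
  change ‖(hmem g).toLp‖ ≤ C * ‖g‖
  rw [Lp.norm_toLp, Lp.norm_def]
  have := ENNReal.toReal_mono (ENNReal.mul_ne_top (by simp) (Lp.eLpNorm_ne_top g)) (hnorm g)
  simpa using this

end Schur

/-- The Neumann series bound for `(1 - T)⁻¹`. -/
lemma exists_inverse_one_sub {E : Type*} [NormedAddCommGroup E] [NormedSpace ℝ E]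
    [CompleteSpace E] (T : E →L[ℝ] E) {c : ℝ} (hT : ‖T‖ ≤ c) (hc : c < 1) :
    ∃ S : E →L[ℝ] E,
      S ∘L (ContinuousLinearMap.id ℝ E - T) = ContinuousLinearMap.id ℝ E ∧
      (ContinuousLinearMap.id ℝ E - T) ∘L S = ContinuousLinearMap.id ℝ E ∧
      ‖S‖ ≤ (1 - c)⁻¹ := by
  set u := Units.oneSub T (hT.trans_lt hc)
  have h1 : (↑u⁻¹ : E →L[ℝ] E) * (1 - T) = 1 := u.inv_mul
  have h2 : (1 - T) * (↑u⁻¹ : E →L[ℝ] E) = 1 := u.mul_inv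
  refine ⟨↑u⁻¹, h1, h2, ?_⟩
  have h3 : (↑u⁻¹ : E →L[ℝ] E) = 1 + T * ↑u⁻¹ := by rw [← h2]; noncomm_ring
  have h4 : ‖(↑u⁻¹ : E →L[ℝ] E)‖ ≤ 1 + c * ‖(↑u⁻¹ : E →L[ℝ] E)‖ := by
    conv_lhs => rw [h3]
    refine (norm_add_le _ _).trans (add_le_add ContinuousLinearMap.norm_id_le ?_)
    exact (norm_mul_le _ _).trans (by gcongr)
  rw [← one_div (1 - c), le_div_iff₀ (by linarith)]
  linarith

/-! ### Solid angle -/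

section SolidAngle

lemma lintegral_Ioo_pow {a : ℝ} (ha : 0 ≤ a) (m : ℕ) :
    ∫⁻ s in Ioo 0 a, ENNReal.ofReal (s ^ m) = ENNReal.ofReal (a ^ (m + 1) / (m + 1)) := by
  rw [Measure.restrict_congr_set Ioo_ae_eq_Ioc,
    ← ofReal_integral_eq_lintegral_ofReal (intervalIntegral.intervalIntegrable_pow m).1,
    ← intervalIntegral.integral_of_le ha]
  · simp
  · filter_upwards [ae_restrict_mem measurableSet_Ioc] with y hy
    exact pow_nonneg hy.1.le _

/-- Integration in polar coordinates. -/
lemma lintegral_polar {G : E3 → ℝ≥0∞} (hG : Measurable G) :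
    ∫⁻ z, G z = ∫⁻ u, (∫⁻ r in Ioi (0 : ℝ), ENNReal.ofReal (r ^ 2) * G (r • (u : E3)))
      ∂(volume : Measure E3).toSphere := by
  have hne : MeasurableSet ({0}ᶜ : Set E3) := (measurableSet_singleton _).compl
  have hdim : Module.finrank ℝ E3 - 1 = 2 := by simp
  have hmp := (volume : Measure E3).measurePreserving_homeomorphUnitSphereProd
  rw [hdim] at hmp
  calc ∫⁻ z, G z = ∫⁻ z in ({0}ᶜ : Set E3), G z := by
        rw [restrict_compl_singleton]
    _ = ∫⁻ z : ({0}ᶜ : Set E3), G z ∂(volume.comap Subtype.val) :=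
        (lintegral_subtype_comap hne _).symm
    _ = ∫⁻ p : Metric.sphere (0 : E3) 1 × Ioi (0 : ℝ), G (p.2.1 • p.1.1)
          ∂((volume : Measure E3).toSphere.prod (Measure.volumeIoiPow 2)) := by
        rw [← hmp.lintegral_comp (by fun_prop)]
        refine lintegral_congr fun z => ?_
        congr 1
        exact congrArg Subtype.val ((homeomorphUnitSphereProd E3).symm_apply_apply z).symm
    _ = _ := by
        rw [lintegral_prod _ (by fun_prop)]
        refine lintegral_congr fun u => ?_
        rw [Measure.volumeIoiPow, lintegral_withDensity_eq_lintegral_mul _ (by fun_prop)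
          (by fun_prop)]
        exact lintegral_subtype_comap measurableSet_Ioi
          (fun r : ℝ => ENNReal.ofReal (r ^ 2) * G (r • (u : E3)))

variable {W : Submodule ℝ E3} {n : E3}

/-- The orthogonal splitting `ℝ³ ≃ ℝ n ⊕ W` defined by a unit normal `n` of a plane `W`. -/
def sliceEquiv (hW : Module.finrank ℝ W = 2) (hn : ‖n‖ = 1) (hperp : ∀ w ∈ W, ⟪n, w⟫ = 0) :
    WithLp 2 (ℝ × W) ≃ₗᵢ[ℝ] E3 :=
  LinearIsometry.toLinearIsometryEquiv
    { toFun := fun p => p.fst • n + (p.snd : E3)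
      map_add' := fun p q => by simp [add_smul]; abel
      map_smul' := fun c p => by simp [smul_smul]
      norm_map' := fun p => by
        rw [← sq_eq_sq₀ (norm_nonneg _) (norm_nonneg _), WithLp.prod_norm_sq_eq_of_L2]
        change ‖p.fst • n + (p.snd : E3)‖ ^ 2 = _
        rw [norm_add_sq_real, inner_smul_left, hperp _ p.snd.2, norm_smul, hn]
        simp }
    (by
      rw [(WithLp.linearEquiv 2 ℝ (ℝ × W)).finrank_eq]
      simp [hW])

lemma lintegral_slice (hW : Module.finrank ℝ W = 2) (hn : ‖n‖ = 1) (hperp : ∀ w ∈ W, ⟪n, w⟫ = 0)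
    {G : E3 → ℝ≥0∞} (hG : Measurable G) :
    ∫⁻ z, G z = ∫⁻ s : ℝ, ∫⁻ q : W, G (s • n + q) := by
  rw [← (sliceEquiv hW hn hperp).measurePreserving.lintegral_comp hG]
  change ∫⁻ a, (G ∘ sliceEquiv hW hn hperp) a = _
  rw [← (WithLp.volume_preserving_toLp ℝ W).lintegral_comp
      (hG.comp (sliceEquiv hW hn hperp).continuous.measurable)]
  exact lintegral_prod _ (Measurable.aemeasurable (by fun_prop))

lemma exists_eq_smul_add (hW : Module.finrank ℝ W = 2) (hn : ‖n‖ = 1)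
    (hperp : ∀ w ∈ W, ⟪n, w⟫ = 0) (p : E3) : ∃ q : W, p = ⟪n, p⟫ • n + q := by
  obtain ⟨z, hz⟩ := (sliceEquiv hW hn hperp).surjective p
  have hz : z.fst • n + (z.snd : E3) = p := hz
  refine ⟨z.snd, ?_⟩
  rw [← hz, inner_add_right, inner_smul_right, hperp _ z.snd.2, real_inner_self_eq_norm_sq, hn]
  simp

lemma norm_smul_add_sq (hn : ‖n‖ = 1) (hperp : ∀ w ∈ W, ⟪n, w⟫ = 0) (s : ℝ) (q : W) :
    ‖s • n + (q : E3)‖ ^ 2 = s ^ 2 + ‖q‖ ^ 2 := by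
  rw [norm_add_sq_real, inner_smul_left, hperp _ q.2, norm_smul, hn]
  simp

lemma inner_smul_add (hn : ‖n‖ = 1) (hperp : ∀ w ∈ W, ⟪n, w⟫ = 0) (s : ℝ) (q : W) :
    ⟪n, s • n + (q : E3)⟫ = s := by
  rw [inner_add_right, inner_smul_right, hperp _ q.2, real_inner_self_eq_norm_sq, hn]
  simp

lemma lintegral_eq_smul {F : Type*} [NormedAddCommGroup F] [InnerProductSpace ℝ F]
    [FiniteDimensional ℝ F] [MeasurableSpace F] [BorelSpace F] (hF : Module.finrank ℝ F = 2)
    {t : ℝ} (ht : 0 < t) {f : F → ℝ≥0∞} (hf : Measurable f) :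
    ∫⁻ q, f q = ENNReal.ofReal (t ^ 2) * ∫⁻ w, f (t • w) := by
  rw [← lintegral_map hf (measurable_const_smul t), Measure.map_addHaar_smul _ ht.ne', hF,
    lintegral_smul_measure, smul_eq_mul, ← mul_assoc, ← ENNReal.ofReal_mul (by positivity),
    abs_of_pos (by positivity), mul_inv_cancel₀ (by positivity), ENNReal.ofReal_one, one_mul]

open Classical in
/-- The solid angle element of a plane at height `h > 0` is `h / ‖y‖³ dy`. Both sides are
three times the integral over the unit ball of the function of degree `0` that `F` defines by
central projection. -/
lemma lintegral_solidAngle_of_pos (hW : Module.finrank ℝ W = 2) (hn : ‖n‖ = 1)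
    (hperp : ∀ w ∈ W, ⟪n, w⟫ = 0) {h : ℝ} (hh : 0 < h) {F : E3 → ℝ≥0∞} (hF : Measurable F) :
    ∫⁻ w : W, F (h • n + w) * ENNReal.ofReal (h / ‖h • n + (w : E3)‖ ^ 3) =
      ∫⁻ u, (if 0 < ⟪n, (u : E3)⟫ then F ((h / ⟪n, (u : E3)⟫) • (u : E3)) else 0)
        ∂(volume : Measure E3).toSphere := by
  set G : E3 → ℝ≥0∞ := fun z =>
    if 0 < ⟪n, z⟫ ∧ ‖z‖ < 1 then F ((h / ⟪n, z⟫) • z) else 0 with hGdef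
  have hG : Measurable G := by
    have m1 : MeasurableSet {z : E3 | 0 < ⟪n, z⟫} := measurableSet_lt (by fun_prop) (by fun_prop)
    have m2 : MeasurableSet {z : E3 | ‖z‖ < 1} := measurableSet_lt (by fun_prop) (by fun_prop)
    exact Measurable.ite (m1.inter m2) (by fun_prop) measurable_const
  -- In polar coordinates `G` depends only on the direction, and `∫₀¹ r² dr = 1 / 3`.
  have hpolar : ∫⁻ z, G z = ENNReal.ofReal (1 / 3) *
      ∫⁻ u, (if 0 < ⟪n, (u : E3)⟫ then F ((h / ⟪n, (u : E3)⟫) • (u : E3)) else 0)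
        ∂(volume : Measure E3).toSphere := by
    rw [lintegral_polar hG, ← lintegral_const_mul' _ _ ENNReal.ofReal_ne_top]
    refine lintegral_congr fun u => ?_
    have hu : ‖(u : E3)‖ = 1 := by simp
    have h1 : ∀ r ∈ Ioi (0 : ℝ), ENNReal.ofReal (r ^ 2) * G (r • (u : E3)) =
        (Ioo 0 1).indicator (fun r => ENNReal.ofReal (r ^ 2)) r *
        (if 0 < ⟪n, (u : E3)⟫ then F ((h / ⟪n, (u : E3)⟫) • (u : E3)) else 0) := by
      intro r hr
      rw [mem_Ioi] at hr
      simp only [hGdef, inner_smul_right, norm_smul, hu, mul_one, Real.norm_of_nonneg hr.le,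
        mul_pos_iff_of_pos_left hr, indicator_apply, mem_Ioo, hr, true_and, smul_smul]
      by_cases hr1 : r < 1
      · by_cases hpos : 0 < ⟪n, (u : E3)⟫
        · have : h / (r * ⟪n, (u : E3)⟫) * r = h / ⟪n, (u : E3)⟫ := by field_simp
          simp [hr1, hpos, this]
        · simp [hpos]
      · simp [hr1]
    rw [setLIntegral_congr_fun measurableSet_Ioi h1, lintegral_mul_const _
      ((by fun_prop : Measurable fun r : ℝ => ENNReal.ofReal (r ^ 2)).indicator measurableSet_Ioo),
      setLIntegral_indicator measurableSet_Ioo,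
      inter_eq_left.2 Ioo_subset_Ioi_self,
      lintegral_Ioo_pow zero_le_one]
    norm_num
  -- The slice at height `s` is the plane at height `h` scaled by `s / h`, and the point `w` of that
  -- plane contributes for `0 < s < h / ‖h • n + w‖`, where the scaled point is in the unit ball.
  have hslice : ∫⁻ z, G z = ENNReal.ofReal (1 / 3) *
      ∫⁻ w : W, F (h • n + w) * ENNReal.ofReal (h / ‖h • n + (w : E3)‖ ^ 3) := by
    have hnorm : ∀ w : W, 0 < ‖h • n + (w : E3)‖ := fun w => by
      have := norm_smul_add_sq hn hperp h w
      have h0 : 0 < ‖h • n + (w : E3)‖ ^ 2 := by rw [this]; positivity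
      exact (sq_pos_iff.1 h0).lt_of_le' (norm_nonneg _)
    have h1 : ∀ s : ℝ, ∫⁻ q : W, G (s • n + q) = ∫⁻ w : W, F (h • n + w) *
        (Ioo 0 (h / ‖h • n + (w : E3)‖)).indicator (fun s => ENNReal.ofReal ((s / h) ^ 2)) s := by
      intro s
      by_cases hs : 0 < s
      · rw [lintegral_eq_smul hW (div_pos hs hh) (by fun_prop),
          ← lintegral_const_mul' _ _ ENNReal.ofReal_ne_top]
        refine lintegral_congr fun w => ?_
        have e1 : s • n + (((s / h) • w : W) : E3) = (s / h) • (h • n + (w : E3)) := by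
          rw [smul_add, smul_smul, div_mul_cancel₀ _ hh.ne']; rfl
        have e2 : ⟪n, (s / h) • (h • n + (w : E3))⟫ = s := by
          rw [inner_smul_right, inner_smul_add hn hperp, div_mul_cancel₀ _ hh.ne']
        have e3 : s / h * ‖h • n + (w : E3)‖ < 1 ↔ s < h / ‖h • n + (w : E3)‖ := by
          rw [lt_div_iff₀ (hnorm w), div_mul_eq_mul_div, div_lt_one hh]
        have e4 : h / s * (s / h) = 1 := by field_simp
        rw [e1]
        simp only [hGdef, e2, hs, true_and, norm_smul, Real.norm_of_nonneg (div_pos hs hh).le, e3,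
          smul_smul, e4, one_smul, indicator_apply, mem_Ioo]
        split_ifs <;> simp [mul_comm]
      · have : ∀ q : W, G (s • n + q) = 0 := fun q => by
          simp [hGdef, inner_smul_add hn hperp, hs]
        simp [this, hs]
    rw [lintegral_slice hW hn hperp hG, lintegral_congr h1, lintegral_lintegral_swap,
      ← lintegral_const_mul' _ _ ENNReal.ofReal_ne_top]
    · refine lintegral_congr fun w => ?_
      rw [lintegral_const_mul _
        ((by fun_prop : Measurable fun s : ℝ => ENNReal.ofReal ((s / h) ^ 2)).indicator
          measurableSet_Ioo), lintegral_indicator measurableSet_Ioo, mul_left_comm]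
      congr 1
      have : ∀ s : ℝ, ENNReal.ofReal ((s / h) ^ 2)
          = ENNReal.ofReal (1 / h ^ 2) * ENNReal.ofReal (s ^ 2) := fun s => by
        rw [← ENNReal.ofReal_mul (by positivity)]; congr 1; field_simp
      have hw := hnorm w
      have hw' := hw.ne'
      rw [lintegral_congr this, lintegral_const_mul' _ _ ENNReal.ofReal_ne_top,
        lintegral_Ioo_pow (by positivity), ← ENNReal.ofReal_mul (by positivity),
        ← ENNReal.ofReal_mul (by positivity)]
      congr 1
      rw [div_pow]
      field_simp
      norm_num
      ring
    · refine Measurable.aemeasurable (Measurable.mul (by fun_prop) ?_)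
      simp only [indicator_apply]
      have m1 : MeasurableSet {z : ℝ × W | 0 < z.1} :=
        measurableSet_lt (by fun_prop) (by fun_prop)
      have m2 : MeasurableSet {z : ℝ × W | z.1 < h / ‖h • n + (z.2 : E3)‖} :=
        measurableSet_lt (by fun_prop) (by fun_prop)
      exact Measurable.ite (m1.inter m2) (by fun_prop) measurable_const
  refine (ENNReal.mul_right_inj ?_ ENNReal.ofReal_ne_top).1 (hslice.symm.trans hpolar)
  simp

open Classical in
/-- The solid angle element of the plane `p + W` as seen from the origin. -/
lemma lintegral_solidAngle (hW : Module.finrank ℝ W = 2) (hn : ‖n‖ = 1)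
    (hperp : ∀ w ∈ W, ⟪n, w⟫ = 0) {p : E3} (hp : ⟪n, p⟫ ≠ 0) {F : E3 → ℝ≥0∞} (hF : Measurable F) :
    ∫⁻ w : W, F (p + w) * ENNReal.ofReal (|⟪n, p⟫| / ‖p + (w : E3)‖ ^ 3) =
      ∫⁻ u, (if 0 < ⟪n, p⟫ / ⟪n, (u : E3)⟫ then F ((⟪n, p⟫ / ⟪n, (u : E3)⟫) • (u : E3)) else 0)
        ∂(volume : Measure E3).toSphere := by
  wlog hpos : 0 < ⟪n, p⟫ generalizing n
  · have := this (n := -n) (by simpa) (by simpa using hperp) (by simpa using hp)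
      (by simpa using lt_of_le_of_ne (not_lt.1 hpos) hp)
    simpa using this
  obtain ⟨q, hq⟩ := exists_eq_smul_add hW hn hperp p
  have h1 := lintegral_solidAngle_of_pos hW hn hperp hpos hF
  rw [← lintegral_add_left_eq_self _ q] at h1
  simp only [Submodule.coe_add, ← add_assoc, ← hq] at h1
  simp only [abs_of_pos hpos, div_pos_iff_of_pos_left hpos]
  exact h1

open Classical in
/-- The cosine of the angle to a unit vector has integral `π` over the hemisphere. -/
lemma lintegral_cosine (hW : Module.finrank ℝ W = 2) (hn : ‖n‖ = 1)
    (hperp : ∀ w ∈ W, ⟪n, w⟫ = 0) :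
    ∫⁻ u, ENNReal.ofReal ⟪n, (u : E3)⟫ ∂(volume : Measure E3).toSphere
      = ENNReal.ofReal Real.pi := by
  set G : E3 → ℝ≥0∞ := (Metric.ball 0 1).indicator fun z => ENNReal.ofReal ⟪n, z⟫ with hGdef
  have hG : Measurable G :=
    Measurable.indicator (by fun_prop) measurableSet_ball
  -- Both evaluations of the integral of `z ↦ ⟪n, z⟫⁺` over the unit ball give `π / 4`: the slice at
  -- height `s` is a disc of area `π (1 - s²)`.
  have hpolar : ∫⁻ z, G z = ENNReal.ofReal (1 / 4) *
      ∫⁻ u, ENNReal.ofReal ⟪n, (u : E3)⟫ ∂(volume : Measure E3).toSphere := by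
    rw [lintegral_polar hG, ← lintegral_const_mul' _ _ ENNReal.ofReal_ne_top]
    refine lintegral_congr fun u => ?_
    have hu : ‖(u : E3)‖ = 1 := by simp
    have h1 : ∀ r ∈ Ioi (0 : ℝ), ENNReal.ofReal (r ^ 2) * G (r • (u : E3)) =
        (Ioo 0 1).indicator (fun r => ENNReal.ofReal (r ^ 3)) r *
          ENNReal.ofReal ⟪n, (u : E3)⟫ := by
      intro r hr
      rw [mem_Ioi] at hr
      simp only [hGdef, indicator_apply, mem_ball_zero_iff, norm_smul, hu, mul_one,
        Real.norm_of_nonneg hr.le, mem_Ioo, hr, true_and, inner_smul_right]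
      split_ifs
      · rw [ENNReal.ofReal_mul hr.le, ← mul_assoc, ← ENNReal.ofReal_mul (by positivity)]
        rfl
      · simp
    rw [setLIntegral_congr_fun measurableSet_Ioi h1, lintegral_mul_const _
      ((by fun_prop : Measurable fun r : ℝ => ENNReal.ofReal (r ^ 3)).indicator measurableSet_Ioo),
      setLIntegral_indicator measurableSet_Ioo,
      inter_eq_left.2 Ioo_subset_Ioi_self,
      lintegral_Ioo_pow zero_le_one]
    norm_num
  have hslice : ∫⁻ z, G z = ENNReal.ofReal (1 / 4) * ENNReal.ofReal Real.pi := by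
    have h1 : ∀ s : ℝ, ∫⁻ q : W, G (s • n + q)
        = (Ioc 0 1).indicator (fun s => ENNReal.ofReal (Real.pi * (s - s ^ 3))) s := by
      intro s
      have h2 : ∀ q : W, G (s • n + q)
          = (Metric.ball (0 : W) √(1 - s ^ 2)).indicator (fun _ => ENNReal.ofReal s) q := by
        intro q
        have : ‖s • n + (q : E3)‖ < 1 ↔ ‖q‖ < √(1 - s ^ 2) := by
          rw [Real.lt_sqrt (norm_nonneg _), lt_sub_iff_add_lt', ← norm_smul_add_sq hn hperp,
            sq_lt_one_iff₀ (norm_nonneg _)]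
        simp only [hGdef, indicator_apply, mem_ball_zero_iff, this, inner_smul_add hn hperp]
      have : Nontrivial W := Module.nontrivial_of_finrank_pos (R := ℝ) (by omega)
      rw [lintegral_congr h2, lintegral_indicator_const measurableSet_ball,
        InnerProductSpace.volume_ball_of_dim_even (k := 1) (by simpa using hW), hW]
      simp only [indicator_apply, mem_Ioc, pow_one, Nat.factorial_one, Nat.cast_one, div_one]
      split_ifs with hs
      · rw [← ENNReal.ofReal_pow (Real.sqrt_nonneg _), Real.sq_sqrt (by nlinarith),
          ← ENNReal.ofReal_mul (by nlinarith), ← ENNReal.ofReal_mul hs.1.le]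
        congr 1
        ring
      · rcases not_and_or.1 hs with hs | hs
        · simp [ENNReal.ofReal_of_nonpos (not_lt.1 hs)]
        · rw [Real.sqrt_eq_zero_of_nonpos (by nlinarith)]
          simp
    rw [lintegral_slice hW hn hperp hG, lintegral_congr h1, lintegral_indicator measurableSet_Ioc,
      ← ofReal_integral_eq_lintegral_ofReal, ← intervalIntegral.integral_of_le zero_le_one,
      ← ENNReal.ofReal_mul (by positivity)]
    · congr 1
      rw [intervalIntegral.integral_const_mul, intervalIntegral.integral_sub
        (by simp) (by simp), integral_id, integral_pow]
      norm_num
      ring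
    · exact (Continuous.intervalIntegrable (by fun_prop) 0 1).1
    · filter_upwards [ae_restrict_mem measurableSet_Ioc] with s hs
      have : s ^ 3 ≤ s := by
        simpa using pow_le_pow_of_le_one hs.1.le hs.2 (by norm_num : 1 ≤ 3)
      exact mul_nonneg Real.pi_pos.le (by linarith)
  refine (ENNReal.mul_right_inj ?_ ENNReal.ofReal_ne_top).1 (hpolar.symm.trans hslice)
  simp

end SolidAngle

/-! ### Triangles -/

lemma isCompact_triangle (v : Fin 3 → E3) : IsCompact (triangle v) :=
  (finite_range v).isCompact_convexHull ℝ

lemma openTriangle_subset (v : Fin 3 → E3) : openTriangle v ⊆ triangle v :=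
  intrinsicInterior_subset

lemma measurableSet_openTriangle (v : Fin 3 → E3) : MeasurableSet (openTriangle v) := by
  have hcl : IsClosed (affineSpan ℝ (triangle v) : Set E3) :=
    AffineSubspace.closed_of_finiteDimensional _
  rw [openTriangle, ← intrinsicClosure_sdiff_intrinsicFrontier]
  exact (isClosed_intrinsicClosure hcl).measurableSet.diff
    (isClosed_intrinsicFrontier hcl).measurableSet

lemma sub_mem_vectorSpan {v : Fin 3 → E3} {x y : E3} (hx : x ∈ triangle v) (hy : y ∈ triangle v) :
    x - y ∈ vectorSpan ℝ (range v) := by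
  rw [← direction_affineSpan]
  exact AffineSubspace.vsub_mem_direction (convexHull_subset_affineSpan _ hx)
    (convexHull_subset_affineSpan _ hy)

/-- A segment is a null set of any plane. -/
lemma volume_preimage_segment {W : Submodule ℝ E3} (hW : Module.finrank ℝ W = 2) (p a b : E3) :
    volume ((fun w : W => p + (w : E3)) ⁻¹' segment ℝ a b) = 0 := by
  let f : W →ᵃ[ℝ] E3 := AffineMap.const ℝ W p + W.subtype.toAffineMap
  have hf : ∀ w : W, f w = p + (w : E3) := fun w => rfl
  refine measure_mono_null (t := ((line[ℝ, a, b]).comap f : Set W)) (fun w hw => ?_)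
    (Measure.addHaar_affineSubspace _ _ fun htop => ?_)
  · rw [AffineSubspace.coe_comap, mem_preimage, hf]
    rw [← convexHull_pair] at hw
    exact convexHull_subset_affineSpan _ hw
  · have hmem : ∀ w : W, p + (w : E3) ∈ line[ℝ, a, b] := fun w => by
      have : w ∈ (line[ℝ, a, b]).comap f := by rw [htop]; trivial
      simpa [AffineSubspace.mem_comap, hf] using this
    have hle : W ≤ vectorSpan ℝ {a, b} := fun w hw => by
      rw [← direction_affineSpan]
      simpa using AffineSubspace.vsub_mem_direction (hmem ⟨w, hw⟩) (hmem 0)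
    have h1 := Submodule.finrank_mono hle
    have h2 := collinear_iff_finrank_le_one.1 (collinear_pair ℝ a b)
    omega

namespace TriangulatedObject

variable (K : TriangulatedObject)

/-! ### Regular points of the faces -/

/-- The points in the relative interior of the `i`-th face that lie on no other face. -/
def regularPart (i : Fin K.N) : Set E3 :=
  openTriangle (K.vertex i) \ ⋃ j ∈ {j | j ≠ i}, triangle (K.vertex j)

variable {K}

lemma finrank_face (i : Fin K.N) :
    Module.finrank ℝ (vectorSpan ℝ (range (K.vertex i))) = 2 :=
  (K.nondegenerate i).finrank_vectorSpan (by simp)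

lemma isOutwardNormal_faceNormal (i : Fin K.N) :
    IsOutwardNormal K.O (K.vertex i) (K.faceNormal i) :=
  (K.exists_normal i).choose_spec.1

lemma isClosed_otherFaces (i : Fin K.N) :
    IsClosed (⋃ j ∈ {j | j ≠ i}, triangle (K.vertex j)) :=
  (toFinite _).isClosed_biUnion fun _ _ => (isCompact_triangle _).isClosed

lemma measurableSet_regularPart (i : Fin K.N) : MeasurableSet (K.regularPart i) :=
  (measurableSet_openTriangle _).diff (isClosed_otherFaces i).measurableSet

lemma regularPart_subset (i : Fin K.N) : K.regularPart i ⊆ openTriangle (K.vertex i) :=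
  sdiff_subset

lemma regularPart_subset_triangle (i : Fin K.N) : K.regularPart i ⊆ triangle (K.vertex i) :=
  (regularPart_subset i).trans (openTriangle_subset _)

lemma eq_of_mem_regularPart {i j : Fin K.N} {x : E3} (hx : x ∈ K.regularPart i)
    (hj : x ∈ triangle (K.vertex j)) : j = i := by
  by_contra hne
  exact hx.2 (mem_biUnion (show j ∈ {j | j ≠ i} from hne) hj)

lemma regularPart_subset_facePoints (i : Fin K.N) : K.regularPart i ⊆ K.facePoints :=
  (regularPart_subset i).trans (subset_iUnion (fun i => openTriangle (K.vertex i)) i)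

lemma facePoints_subset_frontier : K.facePoints ⊆ frontier K.O := by
  rw [K.frontier_eq]
  exact iUnion_mono fun i => openTriangle_subset _

lemma normal_eq {i : Fin K.N} {x : E3} (hx : x ∈ K.regularPart i) :
    K.normal x = K.faceNormal i := by
  have h : ∃ i, x ∈ openTriangle (K.vertex i) := ⟨i, regularPart_subset i hx⟩
  rw [normal, dif_pos h,
    eq_of_mem_regularPart hx (openTriangle_subset _ h.choose_spec)]

/-- Near a regular point, the inner side of the plane of the face belongs to the body: the inner
half of a small ball misses the boundary, and it contains points of the body. -/
lemma exists_halfBall_subset {i : Fin K.N} {x : E3} (hx : x ∈ K.regularPart i) :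
    ∃ r > 0, ∀ z ∈ Metric.ball x r, ⟪K.faceNormal i, z - x⟫ < 0 → z ∈ K.O := by
  obtain ⟨r, hr, hball⟩ := Metric.isOpen_iff.1 (isClosed_otherFaces i).isOpen_compl x hx.2
  refine ⟨r, hr, ?_⟩
  set n := K.faceNormal i
  have hn := isOutwardNormal_faceNormal (K := K) i
  set H : Set E3 := Metric.ball x r ∩ {z | ⟪n, z - x⟫ < 0}
  have hfr : ∀ z ∈ H, z ∉ frontier K.O := by
    rintro z ⟨hz, hz'⟩ hzf
    rw [K.frontier_eq] at hzf
    obtain ⟨j, hj⟩ := mem_iUnion.1 hzf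
    by_cases hji : j = i
    · subst hji
      have := hn.orthogonal _ (sub_mem_vectorSpan hj (regularPart_subset_triangle _ hx))
      exact absurd this (ne_of_lt hz')
    · exact hball hz (mem_biUnion (show j ∈ {j | j ≠ i} from hji) hj)
  have hconv : Convex ℝ H := by
    refine (convex_ball x r).inter ?_
    have : {z : E3 | ⟪n, z - x⟫ < 0} = {z | innerₛₗ ℝ n z < ⟪n, x⟫} := by
      ext z; simp [inner_sub_right]
    rw [this]
    exact convex_halfSpace_lt (innerₛₗ ℝ n).isLinear _
  have hsub : H ⊆ interior K.O ∪ K.Oᶜ := fun z hz => by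
    by_cases hzO : z ∈ K.O
    · left
      by_contra hzi
      exact hfr z hz (by rw [K.isClosed.frontier_eq]; exact ⟨hzO, hzi⟩)
    · exact Or.inr hzO
  have hne : (H ∩ interior K.O).Nonempty := by
    have hev : ∀ᶠ t : ℝ in 𝓝[>] 0, t ∈ Ioo 0 r := Ioo_mem_nhdsGT hr
    obtain ⟨t, ⟨-, htO⟩, ht0, htr⟩ :=
      ((hn.outward x (regularPart_subset i hx)).and hev).exists
    have htH : x - t • n ∈ H := by
      constructor
      · rw [mem_ball_iff_norm]
        simpa [norm_smul, n, hn.norm_eq_one, abs_of_pos ht0] using htr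
      · change ⟪n, x - t • n - x⟫ < 0
        have : x - t • n - x = -(t • n) := by abel
        rw [this, inner_neg_right, inner_smul_right, real_inner_self_eq_norm_sq, hn.norm_eq_one]
        simpa using ht0
    exact ⟨_, htH, (hsub htH).resolve_right (fun h => h htO)⟩
  have := hconv.isPreconnected.subset_left_of_subset_union isOpen_interior
    K.isClosed.isOpen_compl (disjoint_compl_right.mono_left interior_subset) hsub hne
  exact fun z hz hz' => interior_subset (this ⟨hz, hz'⟩)

/-- The interior of the segment between two mutually visible points misses the body. -/
lemma notMem_of_visible {x y : E3} (hxy : segment ℝ x y ∩ K.O = {x, y}) (hne : x ≠ y) {t : ℝ}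
    (ht : t ∈ Ioo (0 : ℝ) 1) : x + t • (y - x) ∉ K.O := by
  intro hO
  have hyx : y - x ≠ 0 := sub_ne_zero.2 hne.symm
  have hz : x + t • (y - x) ∈ ({x, y} : Set E3) := by
    rw [← hxy]
    refine ⟨?_, hO⟩
    rw [segment_eq_image']
    exact ⟨t, ⟨ht.1.le, ht.2.le⟩, rfl⟩
  rcases hz with hz | hz
  · rw [add_eq_left, smul_eq_zero] at hz
    exact hz.elim ht.1.ne' hyx
  · have : (1 - t) • (y - x) = 0 := by
      rw [sub_smul, one_smul, sub_eq_zero]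
      exact sub_eq_iff_eq_add'.2 (mem_singleton_iff.1 hz).symm
    rw [smul_eq_zero] at this
    rcases this with h | h
    · linarith [ht.2]
    · exact hyx h

/-- A point visible from a regular point lies on the outer side of its face. -/
lemma inner_normal_nonneg {i : Fin K.N} {x y : E3} (hx : x ∈ K.regularPart i)
    (hxy : segment ℝ x y ∩ K.O = {x, y}) : 0 ≤ ⟪K.faceNormal i, y - x⟫ := by
  by_contra! hneg
  obtain ⟨r, hr, hO⟩ := exists_halfBall_subset hx
  have hyx : y - x ≠ 0 := by rintro h; simp [h] at hneg
  have hpos : 0 < ‖y - x‖ := norm_pos_iff.2 hyx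
  obtain ⟨t, ht0, ht⟩ : ∃ t : ℝ, 0 < t ∧ t < min 1 (r / ‖y - x‖) :=
    exists_between (lt_min one_pos (by positivity))
  have ht1 : t < 1 := ht.trans_le (min_le_left _ _)
  have htr : t * ‖y - x‖ < r := (lt_div_iff₀ hpos).1 (ht.trans_le (min_le_right _ _))
  have hzO : x + t • (y - x) ∈ K.O := by
    refine hO _ ?_ ?_
    · rw [mem_ball_iff_norm]
      simpa [norm_smul, abs_of_pos ht0] using htr
    · rw [add_sub_cancel_left, inner_smul_right]
      exact mul_neg_of_pos_of_neg ht0 hneg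
  exact notMem_of_visible hxy (sub_ne_zero.1 hyx).symm ⟨ht0, ht1⟩ hzO

/-- Two visible points in the same direction coincide. -/
lemma eq_of_visible_of_visible {x u : E3} {s t : ℝ} (hs : 0 < s) (ht : 0 < t) (hu : u ≠ 0)
    (h1 : segment ℝ x (x + s • u) ∩ K.O = {x, x + s • u})
    (h2 : segment ℝ x (x + t • u) ∩ K.O = {x, x + t • u}) : s = t := by
  by_contra hne
  wlog hst : s < t generalizing s t
  · exact this ht hs h2 h1 (Ne.symm hne) (lt_of_le_of_ne (not_lt.1 hst) (Ne.symm hne))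
  have hO : x + s • u ∈ K.O := (h1.symm ▸ (by simp) : x + s • u ∈ segment ℝ x (x + s • u) ∩ K.O).2
  refine notMem_of_visible h2 ?_ ⟨div_pos hs ht, (div_lt_one ht).2 hst⟩ ?_
  · simp [ht.ne', hu]
  · rwa [add_sub_cancel_left, smul_smul, div_mul_cancel₀ _ ht.ne']

/-! ### The surface measure -/

lemma measurableEmbedding_face (i : Fin K.N) : MeasurableEmbedding
    (fun w : vectorSpan ℝ (range (K.vertex i)) => K.vertex i 0 + (w : E3)) :=
  (measurableEmbedding_addLeft _).comp
    (MeasurableEmbedding.subtype_coe (Submodule.closed_of_finiteDimensional _).measurableSet)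

/-- The points of a face that belong to another face form a null set. -/
lemma regularPart_ae_eq (i : Fin K.N) :
    K.regularPart i =ᵐ[Measure.map
      (fun w : vectorSpan ℝ (range (K.vertex i)) => K.vertex i 0 + (w : E3)) volume]
      openTriangle (K.vertex i) := by
  refine sdiff_ae_eq_self.2 ?_
  refine measure_mono_null (t := ⋃ j ∈ {j | j ≠ i},
    triangle (K.vertex i) ∩ triangle (K.vertex j)) ?_ ?_
  · rw [← inter_iUnion₂]
    exact inter_subset_inter_left _ (openTriangle_subset _)
  · rw [measure_biUnion_null_iff (to_countable _)]
    intro j hj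
    rw [(measurableEmbedding_face i).map_apply]
    rcases K.inter_eq i j (Ne.symm hj) with h | ⟨m, k, h⟩ | ⟨m, k₁, k₂, -, h⟩
    · simp [h]
    · rw [h, ← segment_same ℝ]
      exact volume_preimage_segment (finrank_face i) _ _ _
    · rw [h, convexHull_pair]
      exact volume_preimage_segment (finrank_face i) _ _ _

lemma surfaceMeasure_eq : K.surfaceMeasure = Measure.sum fun i : Fin K.N =>
    (Measure.map (fun w : vectorSpan ℝ (range (K.vertex i)) => K.vertex i 0 + (w : E3))
      volume).restrict (K.regularPart i) := by
  rw [surfaceMeasure]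
  congr 1
  ext1 i
  exact Measure.restrict_congr_set (regularPart_ae_eq i).symm

instance : SFinite K.surfaceMeasure := by
  rw [surfaceMeasure]
  infer_instance

lemma ae_exists_mem_regularPart : ∀ᵐ x ∂K.surfaceMeasure, ∃ i, x ∈ K.regularPart i := by
  rw [surfaceMeasure_eq, Measure.ae_sum_iff]
  intro i
  filter_upwards [ae_restrict_mem (measurableSet_regularPart i)] with x hx using ⟨i, hx⟩

lemma lintegral_surfaceMeasure (f : E3 → ℝ≥0∞) :
    ∫⁻ y, f y ∂K.surfaceMeasure = ∑ i, ∫⁻ w : vectorSpan ℝ (range (K.vertex i)),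
      (K.regularPart i).indicator f (K.vertex i 0 + w) := by
  rw [surfaceMeasure_eq, lintegral_sum_measure, tsum_fintype]
  refine Finset.sum_congr rfl fun i _ => ?_
  rw [← lintegral_indicator (measurableSet_regularPart i),
    (measurableEmbedding_face i).lintegral_map]

lemma aemeasurable_normal : AEMeasurable K.normal K.surfaceMeasure := by
  refine ⟨fun x => ∑ i, (K.regularPart i).indicator (fun _ => K.faceNormal i) x,
    Finset.measurable_fun_sum _ fun i _ => measurable_const.indicator (measurableSet_regularPart i),
    ?_⟩
  filter_upwards [ae_exists_mem_regularPart] with x ⟨i, hx⟩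
  rw [normal_eq hx, Finset.sum_eq_single i, indicator_of_mem hx]
  · intro j _ hji
    exact indicator_of_notMem
      (fun hj => hji (eq_of_mem_regularPart hx (regularPart_subset_triangle _ hj))) _
  · simp

/-! ### Measurability of the visibility between points -/

/-- The visible pairs form a Borel set: obstruction at a parameter bounded away from `0` and `1`
is a closed condition. -/
lemma measurableSet_visible :
    MeasurableSet {p : E3 × E3 | segment ℝ p.1 p.2 ∩ K.O = {p.1, p.2}} := by
  let B : ℕ → Set (E3 × E3) := fun m =>
    Prod.snd '' {q : Icc (1 / ((m : ℝ) + 1)) (1 - 1 / ((m : ℝ) + 1)) × (E3 × E3) |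
      q.2.1 + (q.1 : ℝ) • (q.2.2 - q.2.1) ∈ K.O}
  have hB : ∀ m, IsClosed (B m) := fun m =>
    isClosedMap_snd_of_compactSpace _ (K.isClosed.preimage (by fun_prop))
  have hmem : ∀ p : E3 × E3, p ∈ ⋃ m, B m ↔ ∃ t ∈ Ioo (0 : ℝ) 1,
      p.1 + t • (p.2 - p.1) ∈ K.O := by
    intro p
    simp only [mem_iUnion, B, mem_image, mem_ofPred_eq]
    constructor
    · rintro ⟨m, ⟨⟨t, ht⟩, q⟩, hq, rfl⟩
      have : 0 < 1 / ((m : ℝ) + 1) := by positivity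
      exact ⟨t, ⟨this.trans_le ht.1, by linarith [ht.2]⟩, hq⟩
    · rintro ⟨t, ht, hO⟩
      obtain ⟨m, hm⟩ := exists_nat_one_div_lt (lt_min ht.1 (sub_pos.2 ht.2))
      have h1 := hm.trans_le (min_le_left _ _)
      have h2 := hm.trans_le (min_le_right _ _)
      exact ⟨m, ⟨⟨t, h1.le, by linarith⟩, p⟩, hO, rfl⟩
  have heq : {p : E3 × E3 | segment ℝ p.1 p.2 ∩ K.O = {p.1, p.2}} =
      (Prod.fst ⁻¹' K.O ∩ Prod.snd ⁻¹' K.O) ∩ ({p | p.1 = p.2} ∪ (⋃ m, B m)ᶜ) := by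
    ext p
    rw [mem_inter_iff, mem_union, mem_compl_iff, hmem]
    constructor
    · intro h
      have h : segment ℝ p.1 p.2 ∩ K.O = {p.1, p.2} := h
      have h1 : p.1 ∈ segment ℝ p.1 p.2 ∩ K.O := by rw [h]; simp
      have h2 : p.2 ∈ segment ℝ p.1 p.2 ∩ K.O := by rw [h]; simp
      refine ⟨⟨h1.2, h2.2⟩, or_iff_not_imp_left.2 ?_⟩
      rintro hne ⟨t, ht, hO⟩
      exact notMem_of_visible h hne ht hO
    · rintro ⟨⟨h1, h2⟩, h⟩
      change segment ℝ p.1 p.2 ∩ K.O = {p.1, p.2}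
      refine Subset.antisymm ?_ ?_
      · rintro z ⟨hz, hzO⟩
        rw [segment_eq_image'] at hz
        obtain ⟨t, ht, rfl⟩ := hz
        rcases h with h | h
        · left
          have h : p.1 = p.2 := h
          simp [h]
        · rcases ht.1.eq_or_lt with rfl | h0
          · simp
          rcases ht.2.eq_or_lt with rfl | h1'
          · simp
          exact absurd ⟨t, ⟨h0, h1'⟩, hzO⟩ h
      · rintro z (rfl | rfl)
        · exact ⟨left_mem_segment _ _ _, h1⟩
        · exact ⟨right_mem_segment _ _ _, h2⟩
  rw [heq]
  exact ((K.isClosed.measurableSet.preimage measurable_fst).inter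
    (K.isClosed.measurableSet.preimage measurable_snd)).inter
    ((measurableSet_eq_fun measurable_fst measurable_snd).union
      (MeasurableSet.iUnion fun m => (hB m).measurableSet).compl)

lemma measurable_ptVisibility : Measurable fun p : E3 × E3 => K.ptVisibility p.1 p.2 :=
  Measurable.ite measurableSet_visible measurable_const measurable_const

/-! ### The form factor and its row sums -/

variable (K : TriangulatedObject)

/-- The geometric part of the interreflection kernel, without the albedo. It is symmetric. -/
def formFactor (x y : E3) : ℝ :=
  1 / Real.pi * (⟪K.normal y, x - y⟫ * ⟪K.normal x, y - x⟫ / ‖x - y‖ ^ 4) * K.ptVisibility x y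

variable {K}

lemma kernel_eq (ρ : E3 → ℝ) (x y : E3) : K.kernel ρ x y = ρ x * K.formFactor x y := by
  rw [kernel, formFactor]
  ring

lemma ptVisibility_comm (x y : E3) : K.ptVisibility x y = K.ptVisibility y x := by
  rw [ptVisibility, ptVisibility, segment_symm, pair_comm]

lemma formFactor_comm (x y : E3) : K.formFactor x y = K.formFactor y x := by
  rw [formFactor, formFactor, ptVisibility_comm, norm_sub_rev,
    mul_comm ⟪K.normal y, x - y⟫]

lemma formFactor_nonneg {i j : Fin K.N} {x y : E3} (hx : x ∈ K.regularPart i)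
    (hy : y ∈ K.regularPart j) : 0 ≤ K.formFactor x y := by
  rw [formFactor, ptVisibility]
  split_ifs with h
  · have h1 : 0 ≤ ⟪K.normal x, y - x⟫ := by
      rw [normal_eq hx]; exact inner_normal_nonneg hx h
    have h2 : 0 ≤ ⟪K.normal y, x - y⟫ := by
      rw [normal_eq hy]
      exact inner_normal_nonneg hy (by rw [segment_symm, h, pair_comm])
    positivity
  · simp

lemma aemeasurable_formFactor :
    AEMeasurable (fun p : E3 × E3 => K.formFactor p.1 p.2)
      (K.surfaceMeasure.prod K.surfaceMeasure) := by
  have h1 : AEMeasurable (fun p : E3 × E3 => K.normal p.1)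
      (K.surfaceMeasure.prod K.surfaceMeasure) := aemeasurable_normal.comp_fst
  have h2 : AEMeasurable (fun p : E3 × E3 => K.normal p.2)
      (K.surfaceMeasure.prod K.surfaceMeasure) := aemeasurable_normal.comp_snd
  exact ((((h2.inner (by fun_prop)).mul (h1.inner (by fun_prop))).div
    (by fun_prop)).const_mul _).mul measurable_ptVisibility.aemeasurable

/-- The regular points of the `j`-th face that are visible from `x`, other than `x`. -/
def visiblePart (K : TriangulatedObject) (x : E3) (j : Fin K.N) : Set E3 :=
  {y | y ∈ K.regularPart j ∧ y ≠ x ∧ segment ℝ x y ∩ K.O = {x, y}}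

lemma measurableSet_visiblePart (x : E3) (j : Fin K.N) : MeasurableSet (K.visiblePart x j) :=
  (measurableSet_regularPart j).inter ((measurableSet_singleton x).compl.inter
    (measurableSet_visible.preimage (measurable_const.prodMk measurable_id : Measurable (x, ·))))

open Classical in
/-- The part of the sphere of directions at `x` occupied by the visible regular points of the
`j`-th face, weighted by the cosine of the angle to the normal at `x` over `π`. The ray in the
direction `u` meets the plane of the face at the parameter `⟪n, p⟫ / ⟪n, u⟫`. -/
def faceView (K : TriangulatedObject) (x : E3) (j : Fin K.N) (u : E3) : ℝ≥0∞ :=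
  let t := ⟪K.faceNormal j, K.vertex j 0 - x⟫ / ⟪K.faceNormal j, u⟫
  if 0 < t ∧ x + t • u ∈ K.visiblePart x j then ENNReal.ofReal (⟪K.normal x, u⟫ / Real.pi) else 0

open Classical in
lemma measurable_faceView (x : E3) (j : Fin K.N) : Measurable (K.faceView x j) := by
  have m1 : MeasurableSet {u : E3 |
      0 < ⟪K.faceNormal j, K.vertex j 0 - x⟫ / ⟪K.faceNormal j, u⟫} :=
    measurableSet_lt (by fun_prop) (by fun_prop)
  have m2 : MeasurableSet {u : E3 |
      x + (⟪K.faceNormal j, K.vertex j 0 - x⟫ / ⟪K.faceNormal j, u⟫) • u ∈ K.visiblePart x j} :=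
    (measurableSet_visiblePart x j).preimage (by fun_prop)
  exact Measurable.ite (m1.inter m2) (by fun_prop) measurable_const

/-- Change of variables from a face to the sphere of directions at `x`. -/
lemma lintegral_face_eq {i : Fin K.N} {x : E3} (hx : x ∈ K.regularPart i) (j : Fin K.N) :
    ∫⁻ w : vectorSpan ℝ (range (K.vertex j)),
      (K.regularPart j).indicator (fun y => ENNReal.ofReal (K.formFactor x y)) (K.vertex j 0 + w) =
    ∫⁻ u, K.faceView x j u ∂(volume : Measure E3).toSphere := by
  classical
  set n := K.faceNormal j with hn_def
  have hn := isOutwardNormal_faceNormal (K := K) j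
  set p := K.vertex j 0 - x with hp_def
  let F : E3 → ℝ≥0∞ := fun z => if x + z ∈ K.visiblePart x j then
    ENNReal.ofReal (⟪K.normal x, z⟫ / ‖z‖ / Real.pi) else 0
  have hF : Measurable F := Measurable.ite
    ((measurableSet_visiblePart x j).preimage (by fun_prop)) (by fun_prop) measurable_const
  have hleft : ∀ w : vectorSpan ℝ (range (K.vertex j)),
      (K.regularPart j).indicator (fun y => ENNReal.ofReal (K.formFactor x y)) (K.vertex j 0 + w)
      = F (p + w) * ENNReal.ofReal (|⟪n, p⟫| / ‖p + (w : E3)‖ ^ 3) := by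
    intro w
    set y := K.vertex j 0 + (w : E3) with hy_def
    have hpw : p + (w : E3) = y - x := by rw [hp_def, hy_def]; abel
    have hxy : x + (y - x) = y := by abel
    simp only [F, hpw, hxy]
    by_cases hy : y ∈ K.regularPart j
    · rw [indicator_of_mem hy]
      by_cases hv : y ≠ x ∧ segment ℝ x y ∩ K.O = {x, y}
      · have h1 : 0 ≤ ⟪n, x - y⟫ :=
          inner_normal_nonneg hy (by rw [segment_symm, hv.2, pair_comm])
        have h2 : ⟪n, p⟫ = -⟪n, x - y⟫ := by
          rw [← inner_neg_right, neg_sub, ← hpw, inner_add_right, hn.orthogonal _ w.2, add_zero]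
        have h3 : 0 ≤ ⟪K.normal x, y - x⟫ := by
          rw [normal_eq hx]; exact inner_normal_nonneg hx hv.2
        have hpos : ‖y - x‖ ≠ 0 := norm_ne_zero_iff.2 (sub_ne_zero.2 hv.1)
        rw [if_pos ⟨hy, hv⟩, ← ENNReal.ofReal_mul (by positivity), formFactor, ptVisibility,
          if_pos hv.2, normal_eq hy, h2, abs_neg, abs_of_nonneg h1, norm_sub_rev x y]
        congr 1
        rw [hn_def]
        field_simp
      · rw [if_neg (fun h => hv h.2), zero_mul, formFactor, ptVisibility]
        by_cases hyx : y = x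
        · simp [hyx]
        · rw [if_neg (fun h => hv ⟨hyx, h⟩)]
          simp
    · rw [indicator_of_notMem hy, if_neg (fun h => hy h.1), zero_mul]
  rw [lintegral_congr hleft]
  by_cases h0 : ⟪n, p⟫ = 0
  · simp [faceView, ← hn_def, ← hp_def, h0]
  · rw [lintegral_solidAngle (finrank_face j) hn.norm_eq_one hn.orthogonal h0 hF]
    refine lintegral_congr fun u => ?_
    have hu : ‖(u : E3)‖ = 1 := by simp
    simp only [faceView, ← hn_def, ← hp_def, F]
    split_ifs with h1 h2 h3 h3 h3
    · congr 2
      rw [inner_smul_right, norm_smul, hu, mul_one, Real.norm_of_nonneg h1.le,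
        mul_div_cancel_left₀ _ h1.ne']
    all_goals tauto

/-- Different faces occupy disjoint sets of directions, and these directions are blocked. -/
lemma sum_faceView_le {x : E3} (u : E3) (hu : u ≠ 0) :
    ∑ j, K.faceView x j u ≤
      ENNReal.ofReal (⟪K.normal x, u⟫ / Real.pi * (1 - K.dirVisibility x u)) := by
  classical
  by_cases hex : ∃ j, ∃ t : ℝ, 0 < t ∧ x + t • u ∈ K.visiblePart x j
  · obtain ⟨j, t, ht, hj⟩ := hex
    have hν : K.dirVisibility x u = 0 := by
      rw [dirVisibility, if_neg]
      intro h
      have hO : x + t • u ∈ K.O :=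
        (hj.2.2.symm ▸ (by simp) : x + t • u ∈ segment ℝ x (x + t • u) ∩ K.O).2
      have : x + t • u ∈ ({x} : Set E3) := by
        rw [← h]
        exact ⟨⟨t, ht.le, rfl⟩, hO⟩
      exact hj.2.1 this
    rw [hν, sub_zero, mul_one, Finset.sum_eq_single j]
    · simp only [faceView]
      split_ifs <;> simp
    · intro k _ hkj
      simp only [faceView]
      refine if_neg ?_
      rintro ⟨hs, hk⟩
      have := eq_of_visible_of_visible hs ht hu hk.2.2 hj.2.2
      rw [this] at hk
      exact hkj (eq_of_mem_regularPart hj.1 (regularPart_subset_triangle k hk.1))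
    · simp
  · push Not at hex
    have h0 : ∀ j, K.faceView x j u = 0 := fun j => if_neg fun h => hex j _ h.1 h.2
    simp [h0]

lemma lintegral_normal_hemisphere {x : E3} (hx : x ∈ K.facePoints) :
    ∫⁻ u in {u : Metric.sphere (0 : E3) 1 | 0 ≤ ⟪(u : E3), K.normal x⟫},
      ENNReal.ofReal ⟪K.normal x, (u : E3)⟫ ∂(volume : Measure E3).toSphere
      = ENNReal.ofReal Real.pi := by
  have h : ∃ i, x ∈ openTriangle (K.vertex i) := mem_iUnion.1 hx
  obtain ⟨j, hj⟩ : ∃ j, K.normal x = K.faceNormal j := ⟨_, dif_pos h⟩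
  have hn := isOutwardNormal_faceNormal (K := K) j
  rw [hj, ← lintegral_cosine (finrank_face j) hn.norm_eq_one hn.orthogonal]
  refine setLIntegral_eq_of_support_subset fun u hu => ?_
  change 0 ≤ ⟪(u : E3), K.faceNormal j⟫
  rw [real_inner_comm]
  by_contra! hneg
  exact hu (ENNReal.ofReal_of_nonpos hneg.le)

lemma measurableSet_hemisphere (n : E3) :
    MeasurableSet {u : Metric.sphere (0 : E3) 1 | 0 ≤ ⟪(u : E3), n⟫} :=
  measurableSet_le (by fun_prop) (by fun_prop)

lemma integrable_normal (n : E3) (s : Set (Metric.sphere (0 : E3) 1)) :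
    IntegrableOn (fun u : Metric.sphere (0 : E3) 1 => ⟪n, (u : E3)⟫) s
      (volume : Measure E3).toSphere := by
  refine Integrable.of_bound (by fun_prop) ‖n‖ (Filter.Eventually.of_forall fun u => ?_)
  simpa using norm_inner_le_norm (𝕜 := ℝ) n (u : E3)

lemma integral_normal_hemisphere {x : E3} (hx : x ∈ K.facePoints) :
    ∫ u in {u : Metric.sphere (0 : E3) 1 | 0 ≤ ⟪(u : E3), K.normal x⟫},
      ⟪K.normal x, (u : E3)⟫ ∂(volume : Measure E3).toSphere = Real.pi := by
  have hnn : ∀ u ∈ {u : Metric.sphere (0 : E3) 1 | 0 ≤ ⟪(u : E3), K.normal x⟫},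
      0 ≤ ⟪K.normal x, (u : E3)⟫ := fun u hu => by rw [real_inner_comm]; exact hu
  have h := lintegral_normal_hemisphere hx
  rw [← ofReal_integral_eq_lintegral_ofReal (integrable_normal _ _)
    ((ae_restrict_iff' (measurableSet_hemisphere _)).2 (Filter.Eventually.of_forall hnn)),
    ENNReal.ofReal_eq_ofReal_iff (setIntegral_nonneg (measurableSet_hemisphere _) hnn)
      Real.pi_pos.le] at h
  exact h

lemma dirVisibility_nonneg (x u : E3) : 0 ≤ K.dirVisibility x u := by
  rw [dirVisibility]; split_ifs <;> norm_num

lemma dirVisibility_le_one (x u : E3) : K.dirVisibility x u ≤ 1 := by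
  rw [dirVisibility]; split_ifs <;> norm_num

lemma visibility_nonneg (x : E3) : 0 ≤ K.visibility x := by
  refine mul_nonneg (by positivity) (setIntegral_nonneg (measurableSet_hemisphere _) fun u hu => ?_)
  refine mul_nonneg ?_ (dirVisibility_nonneg _ _)
  rw [real_inner_comm]
  exact hu

lemma visibility_le_one {x : E3} (hx : x ∈ K.facePoints) : K.visibility x ≤ 1 := by
  rw [visibility, one_div, inv_mul_le_one₀ Real.pi_pos, ← integral_normal_hemisphere hx]
  refine integral_mono_of_nonneg ?_ (integrable_normal _ _) ?_
  all_goals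
    refine (ae_restrict_iff' (measurableSet_hemisphere _)).2 (Filter.Eventually.of_forall ?_)
    intro u hu
    have hu : 0 ≤ ⟪K.normal x, (u : E3)⟫ := by rw [real_inner_comm]; exact hu
  · exact mul_nonneg hu (dirVisibility_nonneg _ _)
  · exact mul_le_of_le_one_right hu (dirVisibility_le_one _ _)

/-- The cosine-weighted share of blocked directions in the hemisphere is at most `1 - visibility`.
No measurability of the visibility indicator is needed for the inequality. -/
lemma lintegral_blocked_le {x : E3} (hx : x ∈ K.facePoints) :
    ∫⁻ u, ENNReal.ofReal (⟪K.normal x, (u : E3)⟫ / Real.pi * (1 - K.dirVisibility x u))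
      ∂(volume : Measure E3).toSphere ≤ ENNReal.ofReal (1 - K.visibility x) := by
  set H := {u : Metric.sphere (0 : E3) 1 | 0 ≤ ⟪(u : E3), K.normal x⟫}
  have hnn : ∀ᵐ u : Metric.sphere (0 : E3) 1 ∂((volume : Measure E3).toSphere.restrict H),
      0 ≤ ⟪K.normal x, (u : E3)⟫ := by
    filter_upwards [ae_restrict_mem (measurableSet_hemisphere (K.normal x))] with u hu
    rw [real_inner_comm]
    exact hu
  have hν (u : E3) := sub_nonneg.2 (K.dirVisibility_le_one x u)
  rw [← setLIntegral_eq_of_support_subset (s := H)]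
  swap
  · intro u hu
    change 0 ≤ ⟪(u : E3), K.normal x⟫
    rw [real_inner_comm]
    by_contra! hneg
    exact hu (ENNReal.ofReal_of_nonpos (mul_nonpos_of_nonpos_of_nonneg
      (div_nonpos_of_nonpos_of_nonneg hneg.le Real.pi_pos.le) (hν _)))
  by_cases hint : IntegrableOn (fun u : Metric.sphere (0 : E3) 1 =>
      ⟪K.normal x, (u : E3)⟫ * K.dirVisibility x u) H (volume : Measure E3).toSphere
  · have heq : ∀ u : Metric.sphere (0 : E3) 1,
        ⟪K.normal x, (u : E3)⟫ / Real.pi * (1 - K.dirVisibility x u) = 1 / Real.pi *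
        (⟪K.normal x, (u : E3)⟫ - ⟪K.normal x, (u : E3)⟫ * K.dirVisibility x u) := fun u => by
      ring
    rw [← ofReal_integral_eq_lintegral_ofReal]
    · refine le_of_eq (congrArg _ ?_)
      simp_rw [heq]
      rw [integral_const_mul, integral_sub (integrable_normal _ _) hint,
        integral_normal_hemisphere hx, mul_sub, one_div_mul_cancel Real.pi_ne_zero]
      rfl
    · simp_rw [heq]
      exact ((integrable_normal _ _).sub hint).const_mul _
    · filter_upwards [hnn] with u hu
      exact mul_nonneg (div_nonneg hu Real.pi_pos.le) (hν _)
  -- The junk value of the integral makes the visibility `0`, so that the bound is `1`.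
  · have h0 : K.visibility x = 0 := by
      rw [visibility, integral_undef hint, mul_zero]
    have h1 : ENNReal.ofReal (1 - K.visibility x) =
        ∫⁻ u in H, (ENNReal.ofReal Real.pi)⁻¹ * ENNReal.ofReal ⟪K.normal x, (u : E3)⟫
          ∂(volume : Measure E3).toSphere := by
      rw [lintegral_const_mul' _ _ (by simp [Real.pi_pos]), lintegral_normal_hemisphere hx, h0,
        ENNReal.inv_mul_cancel (by simp [Real.pi_pos]) ENNReal.ofReal_ne_top]
      simp
    rw [h1]
    refine lintegral_mono_ae ?_
    filter_upwards [hnn] with u hu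
    rw [← ENNReal.div_eq_inv_mul, ← ENNReal.ofReal_div_of_pos Real.pi_pos]
    refine ENNReal.ofReal_le_ofReal (mul_le_of_le_one_right (div_nonneg hu Real.pi_pos.le) ?_)
    linarith [K.dirVisibility_nonneg x u]

/-- The row sums of the form factor: the faces visible from `x` cover disjoint sets of blocked
directions. -/
theorem lintegral_formFactor_le {i : Fin K.N} {x : E3} (hx : x ∈ K.regularPart i) :
    ∫⁻ y, ENNReal.ofReal (K.formFactor x y) ∂K.surfaceMeasure
      ≤ ENNReal.ofReal (1 - K.visibility x) := by
  rw [lintegral_surfaceMeasure, Finset.sum_congr rfl fun j _ => lintegral_face_eq hx j,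
    ← lintegral_finsetSum _ (f := fun j (u : Metric.sphere (0 : E3) 1) => K.faceView x j u)
      fun j _ => (measurable_faceView x j).comp measurable_subtype_coe]
  refine le_trans (lintegral_mono fun u => sum_faceView_le (u : E3) ?_)
    (lintegral_blocked_le (regularPart_subset_facePoints i hx))
  exact ne_zero_of_mem_unit_sphere u

/-! ### The extremal visibility and albedo -/

lemma minVisibility_nonneg : 0 ≤ K.minVisibility :=
  Real.sInf_nonneg (by rintro _ ⟨x, -, rfl⟩; exact visibility_nonneg x)

lemma minVisibility_le {x : E3} (hx : x ∈ K.facePoints) : K.minVisibility ≤ K.visibility x :=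
  csInf_le ⟨0, by rintro _ ⟨x, -, rfl⟩; exact visibility_nonneg x⟩ (mem_image_of_mem _ hx)

lemma minVisibility_le_one : K.minVisibility ≤ 1 := by
  rcases K.facePoints.eq_empty_or_nonempty with h | ⟨x, hx⟩
  · simp [minVisibility, h]
  · exact (minVisibility_le hx).trans (visibility_le_one hx)

variable {ρ : E3 → ℝ}

lemma maxAlbedo_nonneg (hρ : ∀ x ∈ frontier K.O, 0 < ρ x ∧ ρ x ≤ 1) : 0 ≤ K.maxAlbedo ρ :=
  Real.sSup_nonneg (by rintro _ ⟨x, hx, rfl⟩; exact (hρ x hx).1.le)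

lemma maxAlbedo_le_one (hρ : ∀ x ∈ frontier K.O, 0 < ρ x ∧ ρ x ≤ 1) : K.maxAlbedo ρ ≤ 1 :=
  Real.sSup_le (by rintro _ ⟨x, hx, rfl⟩; exact (hρ x hx).2) zero_le_one

lemma le_maxAlbedo (hρ : ∀ x ∈ frontier K.O, 0 < ρ x ∧ ρ x ≤ 1) {x : E3} (hx : x ∈ frontier K.O) :
    ρ x ≤ K.maxAlbedo ρ :=
  le_csSup ⟨1, by rintro _ ⟨x, hx, rfl⟩; exact (hρ x hx).2⟩ (mem_image_of_mem _ hx)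

/-! ### The interreflection operator -/

lemma enorm_kernel_le (hρ : ∀ x ∈ frontier K.O, 0 < ρ x ∧ ρ x ≤ 1) {i j : Fin K.N} {x y : E3}
    (hx : x ∈ K.regularPart i) (hy : y ∈ K.regularPart j) :
    ‖K.kernel ρ x y‖ₑ ≤ ENNReal.ofReal (K.maxAlbedo ρ) * ENNReal.ofReal (K.formFactor x y) := by
  have hxf := facePoints_subset_frontier (regularPart_subset_facePoints i hx)
  have h := formFactor_nonneg hx hy
  rw [kernel_eq, Real.enorm_of_nonneg (mul_nonneg (hρ x hxf).1.le h),
    ← ENNReal.ofReal_mul (maxAlbedo_nonneg hρ)]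
  exact ENNReal.ofReal_le_ofReal (mul_le_mul_of_nonneg_right (le_maxAlbedo hρ hxf) h)

lemma lintegral_formFactor_le_minVisibility {i : Fin K.N} {x : E3} (hx : x ∈ K.regularPart i) :
    ∫⁻ y, ENNReal.ofReal (K.maxAlbedo ρ) * ENNReal.ofReal (K.formFactor x y) ∂K.surfaceMeasure
      ≤ ENNReal.ofReal (K.maxAlbedo ρ) * ENNReal.ofReal (1 - K.minVisibility) := by
  rw [lintegral_const_mul' _ _ ENNReal.ofReal_ne_top]
  gcongr
  refine (lintegral_formFactor_le hx).trans (ENNReal.ofReal_le_ofReal ?_)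
  linarith [minVisibility_le (regularPart_subset_facePoints i hx)]

theorem exists_isInterreflectionOperator (hρ : ∀ x ∈ frontier K.O, 0 < ρ x ∧ ρ x ≤ 1)
    (hρ_meas : AEMeasurable ρ K.surfaceMeasure) :
    ∃ T : K.L2 →L[ℝ] K.L2, K.IsInterreflectionOperator ρ T ∧
      ‖T‖ ≤ K.maxAlbedo ρ * (1 - K.minVisibility) := by
  have hC : 0 ≤ K.maxAlbedo ρ * (1 - K.minVisibility) :=
    mul_nonneg (maxAlbedo_nonneg hρ) (sub_nonneg.2 minVisibility_le_one)
  obtain ⟨C, hCeq⟩ : ∃ C : ℝ≥0, (C : ℝ) = K.maxAlbedo ρ * (1 - K.minVisibility) :=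
    ⟨NNReal.mk _ hC, rfl⟩
  have hC' : ENNReal.ofReal (K.maxAlbedo ρ) * ENNReal.ofReal (1 - K.minVisibility) = C := by
    rw [← ENNReal.ofReal_mul (maxAlbedo_nonneg hρ), ← hCeq, ENNReal.ofReal_coe_nnreal]
  have hmeas : AEStronglyMeasurable (fun p : E3 × E3 => K.kernel ρ p.1 p.2)
      (K.surfaceMeasure.prod K.surfaceMeasure) := by
    simp only [kernel_eq]
    exact (hρ_meas.comp_fst.mul aemeasurable_formFactor).aestronglyMeasurable
  have hrow : ∀ᵐ x ∂K.surfaceMeasure, ∫⁻ y, ‖K.kernel ρ x y‖ₑ ∂K.surfaceMeasure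
      ≤ C := by
    filter_upwards [ae_exists_mem_regularPart] with x ⟨i, hx⟩
    refine le_trans (lintegral_mono_ae ?_)
      ((lintegral_formFactor_le_minVisibility (ρ := ρ) hx).trans_eq hC')
    filter_upwards [ae_exists_mem_regularPart] with y ⟨j, hy⟩ using enorm_kernel_le hρ hx hy
  have hcol : ∀ᵐ y ∂K.surfaceMeasure, ∫⁻ x, ‖K.kernel ρ x y‖ₑ ∂K.surfaceMeasure
      ≤ C := by
    filter_upwards [ae_exists_mem_regularPart] with y ⟨j, hy⟩
    refine le_trans (lintegral_mono_ae ?_)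
      ((lintegral_formFactor_le_minVisibility (ρ := ρ) hy).trans_eq hC')
    filter_upwards [ae_exists_mem_regularPart] with x ⟨i, hx⟩
    rw [formFactor_comm y x]
    exact enorm_kernel_le hρ hx hy
  obtain ⟨T, hT, hTg⟩ := exists_clm_of_schur hmeas hrow hcol
  refine ⟨T, fun g => ⟨(hTg g).1, (hTg g).2.trans ?_⟩, hCeq ▸ hT⟩
  filter_upwards [ae_exists_mem_regularPart] with x ⟨i, hx⟩
  rw [interreflect, if_pos (regularPart_subset_facePoints i hx)]

lemma maxAlbedo_mul_lt_one (hρ : ∀ x ∈ frontier K.O, 0 < ρ x ∧ ρ x ≤ 1)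
    (h : 0 < K.minVisibility ∨ K.maxAlbedo ρ < 1) :
    K.maxAlbedo ρ * (1 - K.minVisibility) < 1 := by
  have h0 := maxAlbedo_nonneg hρ
  have h1 := maxAlbedo_le_one hρ
  have h2 := K.minVisibility_nonneg
  have h3 := K.minVisibility_le_one
  rcases h with h | h <;> nlinarith

end TriangulatedObject

end Lambertian

end

theorem lemma5p3 (K : Lambertian.TriangulatedObject) (ρ : Lambertian.E3 → ℝ)
    (hρ : ∀ x ∈ frontier K.O, 0 < ρ x ∧ ρ x ≤ 1)
    (hρ_meas : AEMeasurable ρ K.surfaceMeasure) :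
    ∃ T : K.L2 →L[ℝ] K.L2,
      K.IsInterreflectionOperator ρ T ∧
      ‖T‖ ≤ K.maxAlbedo ρ * (1 - K.minVisibility) ∧
      ((0 < K.minVisibility ∨ K.maxAlbedo ρ < 1) →
        K.maxAlbedo ρ * (1 - K.minVisibility) < 1 ∧
        ‖T‖ < 1 ∧
        ∃ S : K.L2 →L[ℝ] K.L2,
          S ∘L (ContinuousLinearMap.id ℝ K.L2 - T) = ContinuousLinearMap.id ℝ K.L2 ∧
          (ContinuousLinearMap.id ℝ K.L2 - T) ∘L S = ContinuousLinearMap.id ℝ K.L2 ∧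
          ‖S‖ ≤ (1 - K.maxAlbedo ρ * (1 - K.minVisibility))⁻¹) := by
  obtain ⟨T, hT, hTnorm⟩ :=
    Lambertian.TriangulatedObject.exists_isInterreflectionOperator hρ hρ_meas
  refine ⟨T, hT, hTnorm, fun h => ?_⟩
  have hlt := Lambertian.TriangulatedObject.maxAlbedo_mul_lt_one hρ h
  exact ⟨hlt, hTnorm.trans_lt hlt, Lambertian.exists_inverse_one_sub T hTnorm hlt⟩
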